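/- Let $1<\gamma\le 2$ and let $u\in L^1(\mathbb{R})$ (real- or complex-valued) satisfy $\int_{\mathbb{R}}(1+|s|)^{6+\gamma}|\hat u(s)|\,ds<\infty$, where $\hat u(s)=\int_{\mathbb{R}}u(z)e^{-isz}\,dz$; $u$ is identified with its continuous representative. Let $$G(w)=(2-w-w^{-1})^{\gamma/2}\Big[1+\tfrac{\gamma}{24}(2-w-w^{-1})+\tfrac{\gamma(5\gamma+22)}{5760}(2-w-w^{-1})^2\Big],\qquad g_m^{(\gamma)}=\frac1{2\pi}\int_{-\pi}^{\pi}G(e^{is})e^{-ims}\,ds\quad(m\in\mathbb{Z}),$$ and for $h>0$ put $$\delta_h^{\gamma}u(x)=-h^{-\gamma}\sum_{m=-\infty}^{\infty}g_m^{(\gamma)}\,u(x-mh).$$ Let $\partial^{\gamma}_{x,\mathbb{R}}u$ be the Riesz derivative on $\mathbb{R}$, $$\partial^{\gamma}_{x,\mathbb{R}}u(x)=-\frac{1}{2\cos(\frac{\pi}{2}\gamma)\,\Gamma(2-\gamma)}\,\frac{d^2}{dx^2}\int_{\mathbb{R}}|x-s|^{1-\gamma}u(s)\,ds\quad(1<\gamma<2),\qquad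 \partial^{2}_{x,\mathbb{R}}u=u''.$$ Then $\partial^{\gamma}_{x,\mathbb{R}}u(x)$ exists for every $x\in\mathbb{R}$ (for $\gamma<2$ the integral converges absolutely for every $x$ and is twice differentiable in $x$), the series defining $\delta_h^{\gamma}u(x)$ converges absolutely for all $h>0$ and $x\in\mathbb{R}$, and $$\partial^{\gamma}_{x,\mathbb{R}}u(x)=\delta_h^{\gamma}u(x)+O(h^6)\quad\text{as }h\to0^+,\text{ uniformly in }x;$$ that is, there are constants $C$ and $h_0>0$, depending only on $\gamma$ and $u$, such that $|\partial^{\gamma}_{x,\mathbb{R}}u(x)-\delta_h^{\gamma}u(x)|\le C h^6$ for all $0<h<h_0$ and all $x\in\mathbb{R}$. -/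

import Mathlib

open MeasureTheory
open scoped FourierTransform

noncomputable section

/-- The Fourier transform in angular frequency, `û(s) = ∫ u(z) exp(-i s z) dz`
(Mathlib's `𝓕` uses the kernel `exp(-2πi s z)`, whence the rescaling). -/
def angularFourier (u : ℝ → ℂ) (s : ℝ) : ℂ :=
  𝓕 u (s / (2 * Real.pi))

/-- The class of `u ∈ L¹(ℝ)` with `∫ (1 + |s|)^β |û(s)| ds < ∞`. -/
def FourierSmooth (β : ℝ) (u : ℝ → ℂ) : Prop :=
  Integrable u ∧ Integrable (fun s : ℝ => (1 + |s|) ^ β * ‖angularFourier u s‖)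

/-- The integral `∫ |x - s|^(1-γ) u(s) ds` over the real line. -/
def rieszIntegral (γ : ℝ) (u : ℝ → ℂ) (x : ℝ) : ℂ :=
  ∫ s : ℝ, ((|x - s| ^ (1 - γ) : ℝ) : ℂ) * u s

/-- The Riesz derivative of order `γ ∈ (1, 2]` on the real line,
`-1 / (2 cos(πγ/2) Γ(2-γ)) · d²/dx² ∫ |x - s|^(1-γ) u(s) ds`, which for `γ = 2`
(where `1/Γ(2-γ)` vanishes and the integral diverges) is read as usual as its limit `u''`. -/
def rieszDeriv (γ : ℝ) (u : ℝ → ℂ) (x : ℝ) : ℂ :=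
  if γ = 2 then deriv (deriv u) x
  else ((-(1 / (2 * Real.cos (Real.pi / 2 * γ) * Real.Gamma (2 - γ))) : ℝ) : ℂ) *
    deriv (deriv (rieszIntegral γ u)) x

/-- The Riesz derivative of order `γ` exists at every point: the integral in its definition
converges everywhere and is a twice differentiable function (for `γ = 2`: `u` is twice
differentiable). -/
def RieszDifferentiable (γ : ℝ) (u : ℝ → ℂ) : Prop :=
  if γ = 2 then Differentiable ℝ u ∧ Differentiable ℝ (deriv u)
  else (∀ x : ℝ, Integrable (fun s : ℝ => ((|x - s| ^ (1 - γ) : ℝ) : ℂ) * u s)) ∧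
    Differentiable ℝ (rieszIntegral γ u) ∧ Differentiable ℝ (deriv (rieszIntegral γ u))

/-- The generating function `G(w)`. On the unit circle `2 - w - w⁻¹` is real and nonnegative,
so there the power is the ordinary real one. -/
def genFun (γ : ℝ) (w : ℂ) : ℂ :=
  (2 - w - w⁻¹) ^ ((γ / 2 : ℝ) : ℂ) *
    (1 + (γ : ℂ) / 24 * (2 - w - w⁻¹) +
      (γ : ℂ) * (5 * γ + 22) / 5760 * (2 - w - w⁻¹) ^ 2)

/-- The coefficients `g_m = (1/2π) ∫_{-π}^{π} G(exp(is)) exp(-ims) ds`. -/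
def genCoeff (γ : ℝ) (m : ℤ) : ℂ :=
  1 / (2 * (Real.pi : ℂ)) *
    ∫ s in (-Real.pi)..Real.pi,
      genFun γ (Complex.exp (Complex.I * s)) * Complex.exp (-(Complex.I * m * s))

/-- The fractional difference operator `-h^(-γ) ∑_{m ∈ ℤ} g_m u(x - m h)`. -/
def fracDiff (γ h : ℝ) (u : ℝ → ℂ) (x : ℝ) : ℂ :=
  -((h ^ (-γ) : ℝ) : ℂ) * ∑' m : ℤ, genCoeff γ m * u (x - m * h)

end

/-! ### Fourier inversion in angular frequency -/

/-! Both operators are Fourier multipliers. On `exp(isx)` the Riesz derivative acts as `-|s|^γ`, and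
the difference operator as `-h^(-γ) P(hs)`, where `P(y) = G(e^{iy})` depends only on `t = 2 - 2 cos
y`. Since `|y| = 2 arcsin(√t / 2)`, the bracket in `G` is the truncated expansion of `|y|^γ /
t^(γ/2)` in `t`, so `P(y) = |y|^γ (1 + O(y^6))` near 0. As `P` is bounded, `|P(y) - |y|^γ| ≤ C
|y|^(γ+6)` for all `y` (`exists_genProfile_bound`). With `y = hs` the symbols differ by at most `C
h^6 |s|^(γ+6)`, which is integrable against `û`; inversion then gives an error uniform in `x`.

The two symbols need proof. For the difference, the coefficients are absolutely summable because `P`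
agrees on a full period with a `C¹` function (`summable_genCoeff`), and the series may be integrated
termwise (`hasSum_genCoeff_mul_translate`). For the Riesz potential, the kernel is not integrable,
so it is written as a mixture of Gaussians, whose transforms are explicit (`rieszIntegral_eq`). Two
differentiations under the integral sign then turn `|s|^(γ-2)` into `-|s|^γ`. -/

theorem continuous_angularFourier {u : ℝ → ℂ} (hu : Integrable u) :
    Continuous (angularFourier u) := by
  have h : Continuous (𝓕 u) :=
    VectorFourier.fourierIntegral_continuous Real.continuous_fourierChar
      (L := innerₗ ℝ) continuous_inner hu
  exact h.comp (continuous_id.div_const _)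

theorem norm_angularFourier_le (u : ℝ → ℂ) (s : ℝ) : ‖angularFourier u s‖ ≤ ∫ z, ‖u z‖ :=
  VectorFourier.norm_fourierIntegral_le_integral_norm Real.fourierChar volume (innerₗ ℝ) u _

theorem norm_cexp_I_mul (t : ℝ) : ‖Complex.exp (Complex.I * t)‖ = 1 :=
  Complex.norm_exp_I_mul_ofReal t

theorem FourierSmooth.integrable_angularFourier {β : ℝ} (hβ : 0 ≤ β) {u : ℝ → ℂ}
    (hu : FourierSmooth β u) : Integrable (angularFourier u) := by
  refine hu.2.mono' (continuous_angularFourier hu.1).aestronglyMeasurable (.of_forall fun s => ?_)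
  exact le_mul_of_one_le_left (norm_nonneg _)
    (Real.one_le_rpow (by linarith [abs_nonneg s]) hβ)

theorem eq_integral_angularFourier {u : ℝ → ℂ} (hu : Integrable u) (hc : Continuous u)
    (hv : Integrable (angularFourier u)) (x : ℝ) :
    u x = 1 / (2 * Real.pi) * ∫ s : ℝ, Complex.exp (Complex.I * (s * x : ℝ)) * angularFourier u s := by
  have hpi : (2 * Real.pi) ≠ 0 := by positivity
  have hF : Integrable (𝓕 u) := by
    have := hv.comp_mul_left' hpi
    refine this.congr (.of_forall fun s => ?_)
    simp [angularFourier, hpi]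
  have h1 := congrFun (hc.fourierInv_fourier_eq hu hF) x
  rw [Real.fourierInv_eq'] at h1
  have h2 := Measure.integral_comp_mul_left
    (fun s : ℝ => Complex.exp (Complex.I * (s * x : ℝ)) * angularFourier u s) (2 * Real.pi)
  rw [← h1]
  have h3 : (fun v : ℝ => Complex.exp (↑(2 * Real.pi * inner ℝ v x) * Complex.I) • 𝓕 u v) =
      fun v => Complex.exp (Complex.I * ((2 * Real.pi * v) * x : ℝ)) *
        angularFourier u (2 * Real.pi * v) := by
    ext v
    have : angularFourier u (2 * Real.pi * v) = 𝓕 u v := by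
      simp [angularFourier, hpi]
    rw [this, smul_eq_mul]
    congr 2
    simp only [RCLike.inner_apply, conj_trivial]
    push_cast; ring
  rw [h3, h2, abs_of_pos (by positivity), Complex.real_smul]
  push_cast
  ring

theorem integrable_cexp_mul {f : ℝ → ℂ} (hf : Integrable f) (x : ℝ) :
    Integrable (fun s : ℝ => Complex.exp (Complex.I * (s * x : ℝ)) * f s) := by
  refine hf.bdd_mul (c := 1) (by fun_prop) (.of_forall fun s => ?_)
  rw [norm_cexp_I_mul]

theorem hasDerivAt_integral_cexp_mul {f : ℝ → ℂ} (hf : Integrable f)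
    (hf' : Integrable fun s : ℝ => (s : ℂ) * f s) (x : ℝ) :
    HasDerivAt (fun x : ℝ => ∫ s : ℝ, Complex.exp (Complex.I * (s * x : ℝ)) * f s)
      (∫ s : ℝ, Complex.exp (Complex.I * (s * x : ℝ)) * (Complex.I * (s * f s))) x := by
  refine (hasDerivAt_integral_of_dominated_loc_of_deriv_le (s := Set.univ)
    (bound := fun s : ℝ => ‖(s : ℂ) * f s‖) Filter.univ_mem ?_ (integrable_cexp_mul hf x)
    (F' := fun (x s : ℝ) => Complex.exp (Complex.I * (s * x : ℝ)) * (Complex.I * (s * f s)))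
    ?_ ?_ hf'.norm ?_).2
  · exact .of_forall fun x => (integrable_cexp_mul hf x).aestronglyMeasurable
  · exact (integrable_cexp_mul (hf'.const_mul Complex.I) x).aestronglyMeasurable
  · refine .of_forall fun s x _ => ?_
    rw [norm_mul, norm_cexp_I_mul, one_mul, norm_mul, Complex.norm_I, one_mul]
  · refine .of_forall fun s x _ => ?_
    have h : HasDerivAt (fun x : ℝ => Complex.I * ((s * x : ℝ) : ℂ)) (Complex.I * s) x := by
      have := ((hasDerivAt_id x).const_mul s).ofReal_comp.const_mul Complex.I
      simpa using this
    exact (h.cexp.mul_const (f s)).congr_deriv (by ring)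

theorem deriv_deriv_integral_cexp_mul {f : ℝ → ℂ} (hf : Integrable f)
    (hf' : Integrable fun s : ℝ => (s : ℂ) * f s)
    (hf'' : Integrable fun s : ℝ => (s : ℂ) * (s * f s)) (c : ℂ) {F : ℝ → ℂ}
    (hF : ∀ x : ℝ, F x = c * ∫ s : ℝ, Complex.exp (Complex.I * (s * x : ℝ)) * f s) :
    Differentiable ℝ F ∧ Differentiable ℝ (deriv F) ∧
    ∀ x, deriv (deriv F) x =
      -(c * ∫ s : ℝ, Complex.exp (Complex.I * (s * x : ℝ)) * (s * (s * f s))) := by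
  obtain rfl : F = fun x => c * ∫ s : ℝ, Complex.exp (Complex.I * (s * x : ℝ)) * f s := funext hF
  have h1 := fun x => (hasDerivAt_integral_cexp_mul hf hf' x).const_mul c
  have h2 := fun x => (hasDerivAt_integral_cexp_mul (hf'.const_mul Complex.I)
    (f := fun s => Complex.I * (s * f s))
    ((hf''.const_mul Complex.I).congr (.of_forall fun s => by simp only []; ring)) x).const_mul c
  have e : deriv (fun x : ℝ => c * ∫ s : ℝ, Complex.exp (Complex.I * (s * x : ℝ)) * f s) = _ :=
    funext fun x => (h1 x).deriv
  refine ⟨fun x => (h1 x).differentiableAt, ?_, fun x => ?_⟩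
  · rw [e]
    exact fun x => (h2 x).differentiableAt
  · rw [e, (h2 x).deriv, ← mul_neg, ← integral_neg]
    congr 2
    ext s
    linear_combination Complex.exp (Complex.I * (s * x : ℝ)) * (s * (s * f s)) * Complex.I_sq

/-! ### The generating function on the unit circle and its Fourier series -/

/-- The value `G(e^{is})`, as a function of `t = 2 - 2 cos s`. -/
noncomputable def genProfile (γ t : ℝ) : ℝ :=
  t ^ (γ / 2) * (1 + γ / 24 * t + γ * (5 * γ + 22) / 5760 * t ^ 2)

theorem two_sub_cexp_sub_inv (s : ℝ) :
    2 - Complex.exp (Complex.I * s) - (Complex.exp (Complex.I * s))⁻¹ =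
      ((2 - 2 * Real.cos s : ℝ) : ℂ) := by
  rw [← Complex.exp_neg]
  push_cast
  rw [Complex.two_cos, mul_comm Complex.I, ← neg_mul]
  ring

theorem two_sub_two_cos_nonneg (s : ℝ) : 0 ≤ 2 - 2 * Real.cos s := by
  linarith [Real.cos_le_one s]

theorem genFun_cexp (γ s : ℝ) :
    genFun γ (Complex.exp (Complex.I * s)) = (genProfile γ (2 - 2 * Real.cos s) : ℝ) := by
  rw [genFun, two_sub_cexp_sub_inv, genProfile, ← Complex.ofReal_cpow (two_sub_two_cos_nonneg s)]
  push_cast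
  ring

theorem continuous_genProfile_cos {γ : ℝ} (hγ : 0 ≤ γ) :
    Continuous fun s : ℝ => genProfile γ (2 - 2 * Real.cos s) := by
  unfold genProfile
  exact ((by fun_prop : Continuous fun s : ℝ => 2 - 2 * Real.cos s).rpow_const
    fun _ => Or.inr (by linarith)).mul (by fun_prop)

/-- Integration by parts has no boundary term, so the coefficient is of size `|c_n(f')| / |n|`, at
most `1/n² + |c_n(f')|²`; the second term is summable by Parseval. -/
theorem summable_fourierCoeffOn_of_contDiff {a b : ℝ} (hab : a < b) {f : ℝ → ℂ}
    (hf : ContDiff ℝ 1 f) (h : f a = f b) : Summable (fourierCoeffOn hab f) := by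
  have hd : Continuous (deriv f) := hf.continuous_deriv le_rfl
  have hL2 : MemLp (deriv f) 2 (volume.restrict (Set.Ioc a b)) := by
    obtain ⟨C, hC⟩ := (isCompact_Icc (a := a) (b := b)).exists_bound_of_continuousOn hd.continuousOn
    refine MemLp.of_bound hd.aestronglyMeasurable C ?_
    exact (ae_restrict_iff' measurableSet_Ioc).2
      (.of_forall fun x hx => hC x (Set.Ioc_subset_Icc_self hx))
  have h2 := (hasSum_sq_fourierCoeffOn hab hL2).summable
  have h3 : Summable fun n : ℤ => 1 / (n : ℝ) ^ 2 :=
    Real.summable_one_div_int_pow.2 one_lt_two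
  refine Summable.of_norm_bounded_eventually ((h3.add h2).mul_left ((b - a) / (2 * Real.pi))) ?_
  filter_upwards [(Set.finite_singleton (0 : ℤ)).compl_mem_cofinite] with n hn
  have hn : n ≠ 0 := hn
  rw [fourierCoeffOn_of_hasDerivAt hab hn
    (fun x _ => (hf.differentiable one_ne_zero x).hasDerivAt) (hd.intervalIntegrable _ _), h,
    sub_self, mul_zero, zero_sub, ← Complex.ofReal_sub]
  have hba : 0 < b - a := sub_pos.2 hab
  have hn' : 0 < |(n : ℝ)| := by positivity
  simp only [norm_mul, norm_div, norm_neg, norm_one, Complex.norm_I, Complex.norm_real,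
    Complex.norm_intCast, RCLike.norm_ofNat, Real.norm_eq_abs, abs_of_pos Real.pi_pos,
    abs_of_pos hba, mul_one]
  set t := ‖fourierCoeffOn hab (deriv f) n‖
  have : 1 / |(n : ℝ)| * t ≤ 1 / (n : ℝ) ^ 2 + t ^ 2 := by
    rw [← sq_abs (n : ℝ), ← one_div_pow]
    nlinarith [sq_nonneg (1 / |(n : ℝ)| - t), sq_nonneg (1 / |(n : ℝ)| + t)]
  calc 1 / (2 * Real.pi * |(n : ℝ)|) * ((b - a) * t)
      = (b - a) / (2 * Real.pi) * (1 / |(n : ℝ)| * t) := by field_simp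
    _ ≤ _ := by gcongr

/-- Periodicity frees the base point: on `[0, 2π]`, unlike `[-π, π]`, `sin (s/2)` has constant sign.
-/
theorem genCoeff_eq_integral_genProfile (γ : ℝ) (m : ℤ) (a : ℝ) :
    genCoeff γ m = 1 / (2 * Real.pi) * ∫ s in a..a + 2 * Real.pi,
      Complex.exp (-(Complex.I * m * s)) * (genProfile γ (2 - 2 * Real.cos s) : ℝ) := by
  have hp : Function.Periodic (fun s : ℝ => Complex.exp (-(Complex.I * m * s)) *
      (genProfile γ (2 - 2 * Real.cos s) : ℝ)) (2 * Real.pi) := by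
    intro s
    simp only [Real.cos_add_two_pi]
    congr 1
    rw [Complex.exp_eq_exp_iff_exists_int]
    exact ⟨-m, by push_cast; ring⟩
  rw [hp.intervalIntegral_add_eq a (-Real.pi), genCoeff]
  congr 1
  rw [show -Real.pi + 2 * Real.pi = Real.pi by ring]
  exact intervalIntegral.integral_congr fun s _ => by simp only [genFun_cexp]; ring

theorem summable_genCoeff {γ : ℝ} (hγ : 1 ≤ γ) : Summable (genCoeff γ) := by
  -- On `[0, 2π]` one has `√(2 - 2 cos s) = 2 sin (s/2)`, so `f` is the profile there. Elsewhere it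
  -- need not be, but it is `C¹` on the whole line because `γ ≥ 1`.
  let f : ℝ → ℂ := fun s => (((2 * Real.sin (s / 2)) ^ γ * (1 + γ / 24 * (2 * Real.sin (s / 2)) ^ 2 +
    γ * (5 * γ + 22) / 5760 * (2 * Real.sin (s / 2)) ^ 4) : ℝ) : ℂ)
  have hw : ContDiff ℝ 1 fun s : ℝ => 2 * Real.sin (s / 2) :=
    contDiff_const.mul (Real.contDiff_sin.comp (contDiff_id.div_const 2))
  have hf : ContDiff ℝ 1 f := by
    refine Complex.ofRealCLM.contDiff.comp (ContDiff.mul ?_ ?_)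
    · exact (Real.contDiff_rpow_const_of_le (n := 1) (by simpa using hγ)).comp hw
    · exact (contDiff_const.add (contDiff_const.mul (hw.pow 2))).add
        (contDiff_const.mul (hw.pow 4))
  have h0 : f 0 = f (2 * Real.pi) := by simp [f]
  have h := summable_fourierCoeffOn_of_contDiff Real.two_pi_pos hf h0
  refine h.congr fun m => ?_
  rw [genCoeff_eq_integral_genProfile γ m 0, fourierCoeffOn_eq_integral, Complex.real_smul]
  push_cast
  rw [sub_zero, zero_add]
  congr 1
  refine intervalIntegral.integral_congr fun s hs => ?_
  rw [Set.uIcc_of_le Real.two_pi_pos.le] at hs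
  have hs0 : 0 ≤ 2 * Real.sin (s / 2) :=
    mul_nonneg two_pos.le (Real.sin_nonneg_of_nonneg_of_le_pi (by linarith [hs.1])
      (by linarith [hs.2]))
  have hs1 : 2 - 2 * Real.cos s = (2 * Real.sin (s / 2)) ^ 2 := by
    have := Real.cos_sq_add_sin_sq (s / 2)
    have h2 := Real.cos_two_mul (s / 2)
    rw [show 2 * (s / 2) = s by ring] at h2
    rw [h2]; linarith
  simp only [fourier_coe_apply, smul_eq_mul, f, genProfile, hs1]
  congr 2
  · push_cast
    have := Real.pi_ne_zero
    field_simp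
    ring
  · rw [← Real.rpow_natCast_mul hs0]
    norm_num
    rw [show (2 : ℝ) * (γ / 2) = γ by ring]
    ring

theorem hasSum_genCoeff_mul_cexp {γ : ℝ} (hγ : 1 ≤ γ) (s : ℝ) :
    HasSum (fun m : ℤ => genCoeff γ m * Complex.exp (Complex.I * m * s))
      (genProfile γ (2 - 2 * Real.cos s) : ℝ) := by
  have : Fact (0 < 2 * Real.pi) := ⟨Real.two_pi_pos⟩
  let g : ℝ → ℂ := fun s => (genProfile γ (2 - 2 * Real.cos s) : ℝ)
  have hp : Function.Periodic g (2 * Real.pi) := fun s => by simp [g]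
  have hg : Continuous g := Complex.continuous_ofReal.comp (continuous_genProfile_cos (by linarith))
  let F : C(AddCircle (2 * Real.pi), ℂ) := ⟨hp.lift, continuous_coinduced_dom.mpr hg⟩
  have hF : ∀ m, fourierCoeff F m = genCoeff γ m := by
    intro m
    rw [fourierCoeff_eq_intervalIntegral _ _ 0, genCoeff_eq_integral_genProfile γ m 0,
      Complex.real_smul]
    push_cast
    congr 1
    refine intervalIntegral.integral_congr fun s _ => ?_
    simp only [fourier_coe_apply, smul_eq_mul]
    congr 1
    push_cast
    have := Real.pi_ne_zero
    field_simp
  have h := has_pointwise_sum_fourier_series_of_summable (f := F)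
    ((summable_genCoeff hγ).congr fun m => (hF m).symm) (s : AddCircle (2 * Real.pi))
  have e : F (s : AddCircle (2 * Real.pi)) = g s := rfl
  rw [e] at h
  refine h.congr_fun fun m => ?_
  simp only [fourier_coe_apply, smul_eq_mul, hF]
  congr 2
  push_cast
  have := Real.pi_ne_zero
  field_simp

theorem hasSum_genCoeff_mul_translate {γ h : ℝ} (hγ : 1 ≤ γ) {u : ℝ → ℂ} (hu : Integrable u)
    (hc : Continuous u) (hv : Integrable (angularFourier u)) (x : ℝ) :
    HasSum (fun m : ℤ => genCoeff γ m * u (x - m * h))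
      (1 / (2 * Real.pi) * ∫ s : ℝ, Complex.exp (Complex.I * (s * x : ℝ)) *
        ((genProfile γ (2 - 2 * Real.cos (h * s)) : ℝ) * angularFourier u s)) := by
  let F : ℤ → ℝ → ℂ := fun m s => genCoeff γ m *
    (Complex.exp (Complex.I * (s * (x - m * h) : ℝ)) * angularFourier u s)
  have hF : ∀ m, Integrable (F m) := fun m => (integrable_cexp_mul hv _).const_mul _
  have hs : Summable fun m => ∫ s, ‖F m s‖ := by
    have : ∀ m, ∫ s, ‖F m s‖ = ‖genCoeff γ m‖ * ∫ s, ‖angularFourier u s‖ := fun m => by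
      simp only [F, norm_mul, norm_cexp_I_mul, one_mul]
      exact integral_const_mul _ _
    simp only [this]
    exact (summable_genCoeff hγ).norm.mul_right _
  have key := (hasSum_integral_of_summable_integral_norm hF hs).mul_left (1 / (2 * Real.pi) : ℂ)
  have e : (fun s => ∑' m, F m s) = fun s : ℝ => Complex.exp (Complex.I * (s * x : ℝ)) *
      ((genProfile γ (2 - 2 * Real.cos (h * s)) : ℝ) * angularFourier u s) := by
    ext s
    -- Translation by `-mh` contributes `exp(-imhs)`, hence the argument `-(h * s)`; evenness of
    -- cosine removes the sign.
    have h1 := ((hasSum_genCoeff_mul_cexp hγ (-(h * s))).mul_left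
      (Complex.exp (Complex.I * (s * x : ℝ)))).mul_right (angularFourier u s)
    rw [Real.cos_neg] at h1
    rw [← mul_assoc, ← h1.tsum_eq]
    refine tsum_congr fun m => ?_
    simp only [F]
    rw [mul_left_comm (Complex.exp _), ← Complex.exp_add, ← mul_assoc]
    congr 3
    push_cast
    ring
  rw [e] at key
  refine key.congr_fun fun m => ?_
  rw [eq_integral_angularFourier hu hc hv (x - m * h)]
  simp only [F]
  rw [integral_const_mul]
  ring

/-! ### Sixth order of the generating function -/

theorem abs_two_sub_two_cos_sub_le {y : ℝ} (hy : |y| ≤ 1) :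
    |2 - 2 * Real.cos y - (y ^ 2 - y ^ 4 / 12 + y ^ 6 / 360)| ≤ y ^ 8 := by
  have h := Complex.exp_bound (x := y * Complex.I) (by simpa using hy) (n := 8) (by norm_num)
  have h2 := (Complex.abs_re_le_norm _).trans h
  have e : (∑ m ∈ Finset.range 8, ((y : ℂ) * Complex.I) ^ m / (m.factorial : ℂ)) =
      ((1 - y ^ 2 / 2 + y ^ 4 / 24 - y ^ 6 / 720 : ℝ) : ℂ) +
        ((y - y ^ 3 / 6 + y ^ 5 / 120 - y ^ 7 / 5040 : ℝ) : ℂ) * Complex.I := by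
    have h2 := Complex.I_sq
    have h3 : Complex.I ^ 3 = -Complex.I := Complex.I_pow_three
    have h4 := Complex.I_pow_four
    have h5 : Complex.I ^ 5 = Complex.I := by rw [pow_succ, h4, one_mul]
    have h6 : Complex.I ^ 6 = -1 := by rw [pow_succ, h5, ← sq, h2]
    have h7 : Complex.I ^ 7 = -Complex.I := by rw [pow_succ, h6]; ring
    simp only [Finset.sum_range_succ, Finset.sum_range_zero, mul_pow, h2, h3, h4, h5, h6, h7,
      Nat.factorial]
    push_cast
    ring
  rw [e, Complex.sub_re, Complex.exp_ofReal_mul_I_re, Complex.add_re, Complex.ofReal_re,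
    Complex.re_ofReal_mul, Complex.I_re, mul_zero, add_zero, Complex.norm_mul, Complex.norm_I,
    mul_one, Complex.norm_real, Real.norm_eq_abs, Even.pow_abs (by decide)] at h2
  have h3 : (0 : ℝ) ≤ y ^ 8 := Even.pow_nonneg (by decide) y
  -- The remainder constant `9 / (8! * 8)` is well below `1/2`; the factor 2 in `2 cos y` brings the
  -- bound to `y ^ 8`.
  have h4 : y ^ 8 * ((Nat.succ 8 : ℝ) * ((Nat.factorial 8 : ℝ) * (8 : ℕ))⁻¹) ≤ y ^ 8 * (1 / 2) := by
    gcongr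
    norm_num [Nat.factorial]
  have h5 := abs_le.1 (h2.trans h4)
  rw [abs_le]
  constructor <;> linarith [h5.1, h5.2]

theorem exists_one_add_rpow_taylor_bound (β : ℝ) :
    ∃ C, ∃ δ > 0, ∀ w : ℝ, |w| < δ →
      |(1 + w) ^ β - (1 + β * w + β * (β - 1) / 2 * w ^ 2)| ≤ C * |w| ^ 3 := by
  have h := (Real.one_add_rpow_hasFPowerSeriesAt_zero (a := β)).isBigO_sub_partialSum_pow 3
  obtain ⟨C, hC⟩ := h.bound
  obtain ⟨δ, hδ, hb⟩ := Metric.eventually_nhds_iff.1 hC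
  refine ⟨C, δ, hδ, fun w hw => ?_⟩
  have := hb (y := w) (by simpa using hw)
  have e : (binomialSeries ℝ β).partialSum 3 w = 1 + β * w + β * (β - 1) / 2 * w ^ 2 := by
    have h2 := Ring.choose_smul_choose β (n := 2) (k := 1) (by norm_num)
    simp only [Nat.choose_one_right, Ring.choose_one_right, Nat.cast_one, nsmul_eq_mul,
      Nat.cast_ofNat, Nat.add_one_sub_one] at h2
    simp only [FormalMultilinearSeries.partialSum, Finset.sum_range_succ, Finset.sum_range_zero,
      binomialSeries_apply, List.ofFn_const, List.prod_replicate, Ring.choose_zero_right,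
      Ring.choose_one_right, smul_eq_mul]
    linear_combination w ^ 2 / 2 * h2
  simpa [e] using this

/-- With `t = z (1 + w)`, `w = z (-1/12 + z (1/360 + z E))` and a second order expansion of
`(1 + w) ^ β` with remainder `E' w ^ 3`, the product defining the profile is `1 + O(z ^ 3)`. -/
theorem exists_continuous_taylor_remainder (β : ℝ) : ∃ Q : ℝ × ℝ × ℝ → ℝ, Continuous Q ∧
    ∀ z E E' w : ℝ, w = z * (-1 / 12 + z * (1 / 360 + z * E)) →
      (1 + β * w + β * (β - 1) / 2 * w ^ 2 + E' * w ^ 3) *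
        (1 + 2 * β / 24 * (z * (1 + w)) +
          2 * β * (5 * (2 * β) + 22) / 5760 * (z * (1 + w)) ^ 2) = 1 + z ^ 3 * Q (z, E, E') := by
  -- Here `w = z d`. The factors are `1 - (β/12) z + a₂ z² + a₃ z³` and `1 + (β/12) z + p₂ z² + p₃
  -- z³`. The terms in `z` cancel, and so do those in `z²`, because `a₂ + p₂ = β²/144`; this is what
  -- dictates the coefficients of `G`.
  let f : ℝ × ℝ × ℝ → ℝ := fun p => 1 / 360 + p.1 * p.2.1
  let d : ℝ × ℝ × ℝ → ℝ := fun p => -1 / 12 + p.1 * f p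
  let κ : ℝ := β * (5 * β + 11) / 1440
  let b : ℝ := β * (β - 1) / 2
  let a₂ : ℝ := β / 360 + b / 144
  let p₂ : ℝ := -β / 144 + κ
  let a₃ : ℝ × ℝ × ℝ → ℝ := fun p =>
    β * p.2.1 + b * (-f p / 6 + p.1 * f p ^ 2) + p.2.2 * d p ^ 3
  let p₃ : ℝ × ℝ × ℝ → ℝ := fun p => β / 12 * f p + κ * (2 * d p + p.1 * d p ^ 2)
  refine ⟨fun p => a₃ p + p₃ p - β / 12 * p₂ + β / 12 * a₂ +
    p.1 * (-β / 12 * p₃ p + β / 12 * a₃ p + a₂ * p₂) + p.1 ^ 2 * (a₂ * p₃ p + a₃ p * p₂) +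
    p.1 ^ 3 * (a₃ p * p₃ p), by fun_prop, ?_⟩
  rintro z E E' w rfl
  simp only [a₃, p₃, a₂, p₂, b, κ, d, f]
  ring

/-- With `z = y²`, the normalised remainders `E` of the cosine and `E'` of the binomial series stay
in a compact box, on which the continuous `Q` is bounded. -/
theorem exists_genProfile_local_bound (γ : ℝ) :
    ∃ C, ∃ ε > 0, ∀ y : ℝ, |y| < ε → y ≠ 0 →
      |genProfile γ (2 - 2 * Real.cos y) - |y| ^ γ| ≤ C * (|y| ^ γ * |y| ^ 6) := by
  obtain ⟨M, δ, hδ, hM⟩ := exists_one_add_rpow_taylor_bound (γ / 2)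
  obtain ⟨Q, hQ, hQe⟩ := exists_continuous_taylor_remainder (γ / 2)
  obtain ⟨C, hC⟩ := ((isCompact_Icc (a := (0 : ℝ)) (b := 1)).prod
    ((isCompact_Icc (a := (-1 : ℝ)) (b := 1)).prod
      (isCompact_Icc (a := -M) (b := M)))).exists_bound_of_continuousOn hQ.continuousOn
  -- The bound `δ / 2` suffices because `|w| ≤ 2z ≤ 2|y|`.
  refine ⟨C, min 1 (δ / 2), by positivity, fun y hy hy0 => ?_⟩
  have hy1 : |y| ≤ 1 := (hy.trans_le (min_le_left _ _)).le
  have hyd : |y| < δ / 2 := hy.trans_le (min_le_right _ _)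
  have hyp : 0 < |y| := abs_pos.2 hy0
  obtain ⟨z, hz⟩ : ∃ z, z = y ^ 2 := ⟨_, rfl⟩
  have hz0 : 0 < z := by rw [hz]; positivity
  have hzy : z ≤ |y| := by
    rw [hz, ← sq_abs]; nlinarith
  have hz1 : z ≤ 1 := hzy.trans hy1
  have hcos := abs_two_sub_two_cos_sub_le hy1
  rw [show y ^ 8 = z ^ 4 by rw [hz]; ring, show y ^ 6 = z ^ 3 by rw [hz]; ring,
    show y ^ 4 = z ^ 2 by rw [hz]; ring, ← hz] at hcos
  obtain ⟨E, hE⟩ : ∃ E, E = (2 - 2 * Real.cos y - (z - z ^ 2 / 12 + z ^ 3 / 360)) / z ^ 4 :=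
    ⟨_, rfl⟩
  have hE1 : |E| ≤ 1 := by
    rw [hE, abs_div, abs_of_pos (by positivity : 0 < z ^ 4)]
    exact div_le_one_of_le₀ hcos (by positivity)
  obtain ⟨w, hw⟩ : ∃ w, w = z * (-1 / 12 + z * (1 / 360 + z * E)) := ⟨_, rfl⟩
  have ht : 2 - 2 * Real.cos y = z * (1 + w) := by
    rw [hw, hE]; field_simp; ring
  have hw1 : |w| ≤ 2 * z := by
    have : |z * E| ≤ 1 := by
      rw [abs_mul, abs_of_pos hz0]; exact mul_le_one₀ hz1 (abs_nonneg _) hE1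
    obtain ⟨h1, h2⟩ := abs_le.1 this
    rw [hw, abs_mul, abs_of_pos hz0, mul_comm]
    refine mul_le_mul_of_nonneg_right (abs_le.2 ⟨?_, ?_⟩) hz0.le <;> nlinarith
  have hwδ : |w| < δ := by linarith
  have hr : 0 ≤ 1 + w := by
    have := two_sub_two_cos_nonneg y
    rw [ht] at this
    exact nonneg_of_mul_nonneg_right this hz0
  obtain ⟨E', hE'1, hE'⟩ : ∃ E', |E'| ≤ M ∧ (1 + w) ^ (γ / 2) =
      1 + γ / 2 * w + γ / 2 * (γ / 2 - 1) / 2 * w ^ 2 + E' * w ^ 3 := by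
    have h := hM w hwδ
    rcases eq_or_ne w 0 with h0 | h0
    · have hM0 : 0 ≤ M := by
        have := hM (δ / 2) (by rw [abs_of_pos (by positivity)]; linarith)
        exact nonneg_of_mul_nonneg_left ((abs_nonneg _).trans this) (by positivity)
      exact ⟨0, by simpa using hM0, by simp [h0]⟩
    · refine ⟨((1 + w) ^ (γ / 2) -
        (1 + γ / 2 * w + γ / 2 * (γ / 2 - 1) / 2 * w ^ 2)) / w ^ 3, ?_, ?_⟩
      · rw [abs_div, abs_pow, div_le_iff₀ (by positivity)]
        exact h
      · field_simp
        ring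
  have hzγ : z ^ (γ / 2) = |y| ^ γ := by
    rw [hz, ← sq_abs, ← Real.rpow_natCast_mul hyp.le]
    congr 1; push_cast; ring
  have key : genProfile γ (2 - 2 * Real.cos y) = |y| ^ γ * (1 + z ^ 3 * Q (z, E, E')) := by
    rw [ht, genProfile, Real.mul_rpow hz0.le hr, hzγ, hE', mul_assoc, ← hQe z E E' w hw]
    ring
  have hQb : |Q (z, E, E')| ≤ C :=
    hC (z, E, E') ⟨⟨hz0.le, hz1⟩, abs_le.1 hE1, abs_le.1 hE'1⟩
  rw [key, show |y| ^ γ * (1 + z ^ 3 * Q (z, E, E')) - |y| ^ γ =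
    |y| ^ γ * z ^ 3 * Q (z, E, E') by ring, abs_mul, abs_of_nonneg (by positivity), mul_comm,
    show z ^ 3 = |y| ^ 6 by rw [hz, ← sq_abs]; ring]
  gcongr

theorem exists_genProfile_bound {γ : ℝ} (hγ : 0 < γ) :
    ∃ C, ∀ y : ℝ, |genProfile γ (2 - 2 * Real.cos y) - |y| ^ γ| ≤ C * (|y| ^ γ * |y| ^ 6) := by
  obtain ⟨C, ε, hε, hC⟩ := exists_genProfile_local_bound γ
  obtain ⟨B, hB⟩ := (isCompact_Icc (a := (0 : ℝ)) (b := 2 * Real.pi)).exists_bound_of_continuousOn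
    (continuous_genProfile_cos hγ.le).continuousOn
  have hB' : ∀ y, |genProfile γ (2 - 2 * Real.cos y)| ≤ B := fun y => by
    have hp : Function.Periodic (fun y => genProfile γ (2 - 2 * Real.cos y)) (2 * Real.pi) :=
      fun y => by simp
    obtain ⟨t, ht, e⟩ := hp.exists_mem_Ico₀ Real.two_pi_pos y
    rw [e]
    exact hB t (Set.Ico_subset_Icc_self ht)
  have hB0 : 0 ≤ B := (abs_nonneg _).trans (hB' 0)
  -- For `|y| ≥ ε`, the two added terms absorb `B` and `|y| ^ γ` respectively.
  refine ⟨max C (B / (ε ^ γ * ε ^ 6) + 1 / ε ^ 6), fun y => ?_⟩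
  rcases eq_or_ne y 0 with rfl | hy
  · simp [genProfile, hγ.ne']
  · have hyp : 0 < |y| := abs_pos.2 hy
    rcases lt_or_ge |y| ε with h | h
    · exact (hC y h hy).trans (by gcongr; exact le_max_left _ _)
    · calc |genProfile γ (2 - 2 * Real.cos y) - |y| ^ γ|
          ≤ B + |y| ^ γ := (abs_sub _ _).trans
            (add_le_add (hB' y) (abs_of_nonneg (by positivity)).le)
        _ ≤ B / (ε ^ γ * ε ^ 6) * (|y| ^ γ * |y| ^ 6) + 1 / ε ^ 6 * (|y| ^ γ * |y| ^ 6) := by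
            gcongr
            · rw [div_mul_eq_mul_div, le_div_iff₀ (by positivity)]
              gcongr
            · rw [one_div_mul_eq_div, le_div_iff₀ (by positivity)]
              gcongr
        _ = (B / (ε ^ γ * ε ^ 6) + 1 / ε ^ 6) * (|y| ^ γ * |y| ^ 6) := by ring
        _ ≤ _ := by gcongr; exact le_max_right _ _

/-! ### The Riesz potential in frequency space -/

/-- Near `x` the kernel is integrable and `f` bounded; away from `x` the kernel is at most 1 and `f`
integrable. -/
theorem integrable_abs_sub_rpow_mul {a M : ℝ} (ha : -1 < a) (ha0 : a ≤ 0) {f : ℝ → ℂ}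
    (hf : Integrable f) (hM : ∀ s, ‖f s‖ ≤ M) (x : ℝ) :
    Integrable fun s : ℝ => ((|x - s| ^ a : ℝ) : ℂ) * f s := by
  have h1 : IntervalIntegrable (fun t : ℝ => |t| ^ a) volume (-1) 1 := by
    refine intervalIntegrable_of_even (fun t => by rw [abs_neg]) (fun t ht => ?_)
    refine (intervalIntegral.intervalIntegrable_rpow' ha (a := 0) (b := t)).congr
      fun s hs => ?_
    rw [Set.uIoc_of_le ht.le] at hs
    simp only [abs_of_pos hs.1]
  have h2 : Integrable ((Set.Ioc (-1 : ℝ) 1).indicator fun t : ℝ => |t| ^ a) :=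
    (integrable_indicator_iff measurableSet_Ioc).2
      ((intervalIntegrable_iff_integrableOn_Ioc_of_le (by norm_num)).1 h1)
  have hmeas : Measurable fun s : ℝ => ((|x - s| ^ a : ℝ) : ℂ) := by fun_prop
  refine Integrable.mono' (((h2.comp_sub_left x).const_mul M).add hf.norm)
    (hmeas.aestronglyMeasurable.mul hf.aestronglyMeasurable) (.of_forall fun s => ?_)
  have hM0 : 0 ≤ M := (norm_nonneg _).trans (hM s)
  have h0 : 0 ≤ |x - s| ^ a := Real.rpow_nonneg (abs_nonneg _) _
  rw [norm_mul, Complex.norm_real, Real.norm_of_nonneg h0]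
  simp only [Pi.add_apply]
  by_cases hs : x - s ∈ Set.Ioc (-1 : ℝ) 1
  · rw [Set.indicator_of_mem hs]
    have := mul_le_mul_of_nonneg_left (hM s) h0
    linarith [norm_nonneg (f s)]
  · rw [Set.indicator_of_notMem hs, mul_zero, zero_add]
    refine mul_le_of_le_one_left (norm_nonneg _) (Real.rpow_le_one_of_one_le_of_nonpos ?_ ha0)
    by_contra! h
    exact hs ⟨(abs_lt.1 h).1, (abs_lt.1 h).2.le⟩

/-- Since `K ≥ 0`, integrability of `k f` already gives integrability on the product, so Fubini
applies. -/
theorem integral_mul_eq_integral_integral {ν : Measure ℝ} [SFinite ν] {K : ℝ → ℝ → ℝ} {k : ℝ → ℝ}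
    (hK : Measurable (Function.uncurry K)) (hK0 : ∀ t, ∀ᵐ l ∂ν, 0 ≤ K t l)
    (hi : ∀ᵐ t, Integrable (K t) ν) (hk : ∀ᵐ t, ∫ l, K t l ∂ν = k t) {f : ℝ → ℂ}
    (hf : AEStronglyMeasurable f) (hkf : Integrable fun t => (k t : ℂ) * f t) :
    ∫ t, (k t : ℂ) * f t = ∫ l, ∫ t, (K t l : ℂ) * f t ∂volume ∂ν := by
  have hm : AEStronglyMeasurable (Function.uncurry fun t l => (K t l : ℂ) * f t)
      (volume.prod ν) :=
    (Complex.measurable_ofReal.comp hK).aestronglyMeasurable.mul hf.comp_fst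
  have hI : Integrable (Function.uncurry fun t l => (K t l : ℂ) * f t) (volume.prod ν) := by
    refine (integrable_prod_iff hm).2 ⟨?_, ?_⟩
    · filter_upwards [hi] with t ht
      exact ht.ofReal.mul_const (f t)
    · refine hkf.norm.congr ?_
      filter_upwards [hk] with t ht
      have h0 : 0 ≤ k t := ht ▸ integral_nonneg_of_ae (hK0 t)
      simp only [Function.uncurry_apply_pair, norm_mul, Complex.norm_real, Real.norm_of_nonneg h0]
      rw [integral_mul_const, ← ht]
      congr 1
      exact integral_congr_ae ((hK0 t).mono fun l hl => by
        simp only [Real.norm_of_nonneg hl])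
  rw [← integral_integral_swap hI]
  refine integral_congr_ae ?_
  filter_upwards [hk] with t ht
  rw [integral_mul_const, integral_complex_ofReal, ht]

theorem integral_rpow_mul_exp_neg_sq {α r : ℝ} (hα : 0 < α) (hr : r ≠ 0) :
    ∫ l in Set.Ioi (0 : ℝ), l ^ (α / 2 - 1) * Real.exp (-(r ^ 2 * l)) =
      Real.Gamma (α / 2) * |r| ^ (-α) := by
  rw [Real.integral_rpow_mul_exp_neg_mul_Ioi (by positivity) (by positivity), mul_comm]
  congr 1
  rw [one_div, Real.inv_rpow (by positivity), ← sq_abs, ← Real.rpow_natCast_mul (abs_nonneg r),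
    Real.rpow_neg (abs_nonneg r)]
  congr 2
  push_cast; ring

/-- The substitution `l ↦ 1/l` reduces this to the previous integral with `1 - α` for `α` and `r =
s/2`. -/
theorem integral_rpow_mul_exp_neg_inv {α s : ℝ} (hα : α < 1) (hs : s ≠ 0) :
    ∫ l in Set.Ioi (0 : ℝ), l ^ (α / 2 - 1) * (√(Real.pi / l) * Real.exp (-(s ^ 2 / (4 * l)))) =
      √Real.pi * 2 ^ (1 - α) * Real.Gamma ((1 - α) / 2) * |s| ^ (α - 1) := by
  have h1 := integral_comp_rpow_Ioi
    (fun y : ℝ => y ^ ((1 - α) / 2 - 1) * Real.exp (-((s / 2) ^ 2 * y)))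
    (p := -1) (by norm_num)
  rw [integral_rpow_mul_exp_neg_sq (by linarith) (by positivity)] at h1
  have h2 : ∀ l ∈ Set.Ioi (0 : ℝ),
      l ^ (α / 2 - 1) * (√(Real.pi / l) * Real.exp (-(s ^ 2 / (4 * l)))) =
      √Real.pi * ((|(-1 : ℝ)| * l ^ ((-1 : ℝ) - 1)) • ((l ^ (-1 : ℝ)) ^ ((1 - α) / 2 - 1) *
        Real.exp (-((s / 2) ^ 2 * l ^ (-1 : ℝ))))) := by
    intro l hl
    have hl : 0 < l := hl
    have e1 : √(Real.pi / l) = √Real.pi * l ^ (-(1 / 2) : ℝ) := by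
      rw [Real.sqrt_div' _ hl.le, Real.sqrt_eq_rpow l, Real.rpow_neg hl.le, div_eq_mul_inv]
    have e2 : s ^ 2 / (4 * l) = (s / 2) ^ 2 * l ^ (-1 : ℝ) := by
      rw [Real.rpow_neg_one]; field_simp; norm_num
    have e3 : l ^ (α / 2 - 1) * l ^ (-(1 / 2) : ℝ) =
        l ^ ((-1 : ℝ) - 1) * (l ^ (-1 : ℝ)) ^ ((1 - α) / 2 - 1) := by
      rw [← Real.rpow_mul hl.le, ← Real.rpow_add hl, ← Real.rpow_add hl]
      congr 1; ring
    rw [e1, e2, abs_neg, abs_one, one_mul, smul_eq_mul]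
    linear_combination √Real.pi * Real.exp (-((s / 2) ^ 2 * l ^ (-1 : ℝ))) * e3
  rw [setIntegral_congr_fun measurableSet_Ioi h2, integral_const_mul, h1, abs_div,
    Real.div_rpow (abs_nonneg _) (abs_nonneg _), abs_two,
    show -(1 - α) = α - 1 by ring, show (α - 1) = -(1 - α) by ring, Real.rpow_neg two_pos.le]
  field_simp

theorem integral_gaussian_mul_eq {l : ℝ} (hl : 0 < l) {u : ℝ → ℂ} (hu : Integrable u)
    (hc : Continuous u) (hv : Integrable (angularFourier u)) (x : ℝ) :
    ∫ t : ℝ, (Real.exp (-((x - t) ^ 2 * l)) : ℂ) * u t =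
      1 / (2 * Real.pi) * ∫ s : ℝ, ((√(Real.pi / l) * Real.exp (-(s ^ 2 / (4 * l))) : ℝ) : ℂ) *
        (Complex.exp (Complex.I * (s * x : ℝ)) * angularFourier u s) := by
  have hg : Integrable fun t : ℝ => (Real.exp (-((x - t) ^ 2 * l)) : ℂ) := by
    have := ((integrable_exp_neg_mul_sq hl).comp_sub_left x).ofReal (𝕜 := ℂ)
    refine this.congr (.of_forall fun t => ?_)
    simp only []
    congr 2
    ring
  have hI : Integrable (Function.uncurry fun t s : ℝ => Complex.exp (Complex.I * (s * t : ℝ)) *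
      ((Real.exp (-((x - t) ^ 2 * l)) : ℂ) * angularFourier u s)) (volume.prod volume) := by
    refine (hg.mul_prod hv).bdd_mul (c := 1) ?_ (.of_forall fun p => (norm_cexp_I_mul _).le)
    exact Continuous.aestronglyMeasurable (by fun_prop)
  have hG : ∀ s : ℝ, ∫ t : ℝ, Complex.exp (Complex.I * (s * t : ℝ)) *
      (Real.exp (-((x - t) ^ 2 * l)) : ℂ) =
      ((√(Real.pi / l) * Real.exp (-(s ^ 2 / (4 * l))) : ℝ) : ℂ) *
        Complex.exp (Complex.I * (s * x : ℝ)) := by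
    intro s
    have h := fourierIntegral_gaussian (b := l) (by simpa using hl) s
    rw [← integral_add_right_eq_self _ x]
    have e : (fun t : ℝ => Complex.exp (Complex.I * (s * (t + x) : ℝ)) *
        (Real.exp (-((x - (t + x)) ^ 2 * l)) : ℂ)) = fun t : ℝ =>
        Complex.exp (Complex.I * (s * x : ℝ)) *
        (Complex.exp (Complex.I * s * t) * Complex.exp (-(l : ℂ) * (t : ℂ) ^ 2)) := by
      ext t
      push_cast
      rw [← Complex.exp_add, ← Complex.exp_add, ← Complex.exp_add]
      congr 1
      ring
    rw [e, integral_const_mul, h, mul_comm]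
    congr 1
    rw [Real.sqrt_eq_rpow]
    push_cast
    rw [Complex.ofReal_cpow (by positivity)]
    push_cast
    congr 2
    ring
  calc ∫ t : ℝ, (Real.exp (-((x - t) ^ 2 * l)) : ℂ) * u t
      = 1 / (2 * Real.pi) * ∫ t : ℝ, ∫ s : ℝ, Complex.exp (Complex.I * (s * t : ℝ)) *
          ((Real.exp (-((x - t) ^ 2 * l)) : ℂ) * angularFourier u s) := by
        rw [← integral_const_mul]
        congr 1
        ext t
        rw [eq_integral_angularFourier hu hc hv t, mul_left_comm, ← integral_const_mul]
        congr 2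
        ext s
        ring
    _ = _ := by
        rw [integral_integral_swap hI]
        congr 2
        ext s
        rw [← mul_assoc, ← hG s, ← integral_mul_const]
        congr 1
        ext t
        ring

/-- Duplication at `(1 - α)/2` combined with reflection at `α/2`. -/
theorem Gamma_half_mul_rieszConstant {α : ℝ} (h0 : 0 < α) (h1 : α < 1) :
    √Real.pi * 2 ^ (1 - α) * Real.Gamma ((1 - α) / 2) =
      Real.Gamma (α / 2) * (2 * Real.sin (Real.pi / 2 * α) * Real.Gamma (1 - α)) := by
  have hd := Real.Gamma_mul_Gamma_add_half ((1 - α) / 2)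
  have hr := Real.Gamma_mul_Gamma_one_sub (α / 2)
  rw [show (1 - α) / 2 + 1 / 2 = 1 - α / 2 by ring, show 2 * ((1 - α) / 2) = 1 - α by ring,
    show 1 - (1 - α) = α by ring] at hd
  rw [show Real.pi * (α / 2) = Real.pi / 2 * α by ring] at hr
  have hs : 0 < Real.sin (Real.pi / 2 * α) :=
    Real.sin_pos_of_pos_of_lt_pi (by positivity) (by nlinarith [Real.pi_pos])
  have hG : 0 < Real.Gamma (1 - α / 2) := Real.Gamma_pos_of_pos (by linarith)
  rw [eq_div_iff hs.ne'] at hr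
  have hp : (2 : ℝ) ^ (1 - α) * 2 ^ α = 2 := by
    rw [← Real.rpow_add two_pos]; simp
  have hq : √Real.pi * √Real.pi = Real.pi := Real.mul_self_sqrt Real.pi_pos.le
  refine mul_right_cancel₀ hG.ne' ?_
  linear_combination √Real.pi * 2 ^ (1 - α) * hd + √Real.pi * √Real.pi * Real.Gamma (1 - α) * hp
    + 2 * Real.Gamma (1 - α) * hq - 2 * Real.Gamma (1 - α) * hr

theorem rieszIntegral_eq {γ : ℝ} (h1 : 1 < γ) (h2 : γ < 2) {u : ℝ → ℂ} (hu : Integrable u)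
    (hc : Continuous u) (hv : Integrable (angularFourier u))
    (huw : ∀ x : ℝ, Integrable fun s : ℝ => ((|x - s| ^ (1 - γ) : ℝ) : ℂ) * u s)
    (hvw : Integrable fun s : ℝ => ((|s| ^ (γ - 2) : ℝ) : ℂ) * angularFourier u s) (x : ℝ) :
    rieszIntegral γ u x =
      ((-(2 * Real.cos (Real.pi / 2 * γ) * Real.Gamma (2 - γ)) : ℝ) : ℂ) * (1 / (2 * Real.pi)) *
        ∫ s : ℝ, Complex.exp (Complex.I * (s * x : ℝ)) *
          (((|s| ^ (γ - 2) : ℝ) : ℂ) * angularFourier u s) := by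
  obtain ⟨α, rfl⟩ : ∃ α, γ = α + 1 := ⟨γ - 1, by ring⟩
  have hα0 : 0 < α := by linarith
  have hα1 : α < 1 := by linarith
  rw [show α + 1 - 2 = α - 1 by ring] at hvw
  simp only [show 1 - (α + 1) = -α by ring] at huw
  rw [rieszIntegral, show 2 - (α + 1) = 1 - α by ring, show α + 1 - 2 = α - 1 by ring,
    show 1 - (α + 1) = -α by ring, show Real.pi / 2 * (α + 1) = Real.pi / 2 * α + Real.pi / 2 by ring,
    Real.cos_add_pi_div_two, mul_neg, neg_mul, neg_neg]
  set A := Real.Gamma (α / 2) with hA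
  have hApos : 0 < A := Real.Gamma_pos_of_pos (by linarith)
  have hBpos : 0 < Real.Gamma ((1 - α) / 2) := Real.Gamma_pos_of_pos (by linarith)
  set B := √Real.pi * 2 ^ (1 - α) * Real.Gamma ((1 - α) / 2) with hB
  have hAB := Gamma_half_mul_rieszConstant hα0 hα1
  rw [← hA, ← hB] at hAB
  have hne : ∀ y : ℝ, ∀ᵐ t : ℝ, t ≠ y := fun y => by
    simp [ae_iff, measure_singleton]
  have hpos : ∀ᵐ l ∂(volume.restrict (Set.Ioi (0 : ℝ))), 0 < l := ae_restrict_mem measurableSet_Ioi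
  have e1 := integral_mul_eq_integral_integral (ν := volume.restrict (Set.Ioi 0))
    (K := fun t l => l ^ (α / 2 - 1) * Real.exp (-((x - t) ^ 2 * l)))
    (k := fun t => A * |x - t| ^ (-α)) (f := u) (by unfold Function.uncurry; fun_prop)
    (fun t => hpos.mono fun l hl => by positivity)
    (by
      filter_upwards [hne x] with t ht
      -- A non-integrable function has integral 0 by convention, so the nonzero value itself proves
      -- integrability.
      refine Integrable.of_integral_ne_zero ?_
      have h : x - t ≠ 0 := sub_ne_zero.2 ht.symm
      rw [integral_rpow_mul_exp_neg_sq hα0 h]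
      positivity)
    (by
      filter_upwards [hne x] with t ht
      exact integral_rpow_mul_exp_neg_sq hα0 (sub_ne_zero.2 ht.symm))
    hc.aestronglyMeasurable
    (((huw x).const_mul (A : ℂ)).congr (.of_forall fun t => by push_cast; ring))
  have e2 := integral_mul_eq_integral_integral (ν := volume.restrict (Set.Ioi 0))
    (K := fun s l => l ^ (α / 2 - 1) * (√(Real.pi / l) * Real.exp (-(s ^ 2 / (4 * l)))))
    (k := fun s => B * |s| ^ (α - 1))
    (f := fun s => Complex.exp (Complex.I * (s * x : ℝ)) * angularFourier u s)
    (by unfold Function.uncurry; fun_prop)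
    (fun t => hpos.mono fun l hl => by positivity)
    (by
      filter_upwards [hne 0] with t ht
      refine Integrable.of_integral_ne_zero ?_
      rw [integral_rpow_mul_exp_neg_inv hα1 ht]
      positivity)
    (by
      filter_upwards [hne 0] with t ht
      exact integral_rpow_mul_exp_neg_inv hα1 ht)
    (integrable_cexp_mul hv x).aestronglyMeasurable
    (((integrable_cexp_mul hvw x).const_mul (B : ℂ)).congr
      (.of_forall fun t => by push_cast; ring))
  have e3 : ∫ l in Set.Ioi (0 : ℝ), ∫ t : ℝ,
        ((l ^ (α / 2 - 1) * Real.exp (-((x - t) ^ 2 * l)) : ℝ) : ℂ) * u t =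
      1 / (2 * Real.pi) * ∫ l in Set.Ioi (0 : ℝ), ∫ s : ℝ,
        ((l ^ (α / 2 - 1) * (√(Real.pi / l) * Real.exp (-(s ^ 2 / (4 * l)))) : ℝ) : ℂ) *
        (Complex.exp (Complex.I * (s * x : ℝ)) * angularFourier u s) := by
    rw [← integral_const_mul]
    refine setIntegral_congr_fun measurableSet_Ioi fun l hl => ?_
    simp only [Complex.ofReal_mul (l ^ (α / 2 - 1)), mul_assoc (Complex.ofReal (l ^ (α / 2 - 1)))]
    rw [integral_const_mul, integral_const_mul, integral_gaussian_mul_eq hl hu hc hv]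
    ring
  rw [← e1, ← e2] at e3
  simp only [Complex.ofReal_mul, mul_assoc (Complex.ofReal A), mul_assoc (Complex.ofReal B)] at e3
  rw [integral_const_mul, integral_const_mul] at e3
  refine mul_left_cancel₀ (Complex.ofReal_ne_zero.2 hApos.ne') (e3.trans ?_)
  rw [hAB]
  simp only [mul_left_comm (Complex.exp _)]
  push_cast
  ring

/-! ### Sixth order accuracy of the fractional difference operator -/

theorem FourierSmooth.integrable_mul {β : ℝ} {u : ℝ → ℂ} (hu : FourierSmooth β u) {w : ℝ → ℂ}
    (hw : Measurable w) (hb : ∀ s, ‖w s‖ ≤ (1 + |s|) ^ β) :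
    Integrable fun s => w s * angularFourier u s := by
  refine hu.2.mono' (hw.aestronglyMeasurable.mul
    (continuous_angularFourier hu.1).aestronglyMeasurable) (.of_forall fun s => ?_)
  rw [norm_mul]
  exact mul_le_mul_of_nonneg_right (hb s) (norm_nonneg _)

theorem abs_rpow_le_one_add_abs_rpow {a β : ℝ} (ha : 0 ≤ a) (hab : a ≤ β) (s : ℝ) :
    |s| ^ a ≤ (1 + |s|) ^ β :=
  (Real.rpow_le_rpow (abs_nonneg s) (by linarith) ha).trans
    (Real.rpow_le_rpow_of_exponent_le (by linarith [abs_nonneg s]) hab)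

theorem abs_pow_le_one_add_abs_rpow {n : ℕ} {β : ℝ} (hn : n ≤ β) (s : ℝ) :
    |s| ^ n ≤ (1 + |s|) ^ β := by
  rw [← Real.rpow_natCast]
  exact abs_rpow_le_one_add_abs_rpow n.cast_nonneg hn s

theorem rieszDifferentiable_and_rieszDeriv_eq {γ : ℝ} (h1 : 1 < γ) (h2 : γ ≤ 2) {u : ℝ → ℂ}
    (hu : FourierSmooth (6 + γ) u) (hc : Continuous u) :
    RieszDifferentiable γ u ∧ ∀ x, rieszDeriv γ u x =
      -(1 / (2 * Real.pi) * ∫ s : ℝ, Complex.exp (Complex.I * (s * x : ℝ)) *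
        (((|s| ^ γ : ℝ) : ℂ) * angularFourier u s)) := by
  have hv := hu.integrable_angularFourier (by linarith)
  rcases h2.eq_or_lt with rfl | h2
  · have i1 := hu.integrable_mul (w := fun s => s) (by fun_prop) fun s => by
      simpa using abs_pow_le_one_add_abs_rpow (n := 1) (β := 6 + 2) (by norm_num) s
    have i2 : Integrable fun s : ℝ => (s : ℂ) * (s * angularFourier u s) :=
      (hu.integrable_mul (w := fun s => s ^ 2) (by fun_prop) fun s => by
        simpa using abs_pow_le_one_add_abs_rpow (n := 2) (β := 6 + 2) (by norm_num) s).congr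
        (.of_forall fun s => by simp only []; ring)
    obtain ⟨d1, d2, d3⟩ := deriv_deriv_integral_cexp_mul hv i1 i2 _
      (eq_integral_angularFourier hu.1 hc hv)
    refine ⟨by rw [RieszDifferentiable, if_pos rfl]; exact ⟨d1, d2⟩, fun x => ?_⟩
    rw [rieszDeriv, if_pos rfl, d3]
    congr 3
    ext s
    rw [Real.rpow_two, sq_abs]
    push_cast
    ring
  · have huM : ∀ x, ‖u x‖ ≤ 1 / (2 * Real.pi) * ∫ s, ‖angularFourier u s‖ := fun x => by
      rw [eq_integral_angularFourier hu.1 hc hv x, norm_mul]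
      refine mul_le_mul (le_of_eq ?_) ((norm_integral_le_integral_norm _).trans (le_of_eq ?_))
        (norm_nonneg _) (by positivity)
      · simp [abs_of_pos Real.pi_pos]
      · simp only [norm_mul, norm_cexp_I_mul, one_mul]
    have huw := integrable_abs_sub_rpow_mul (by linarith : -1 < 1 - γ) (by linarith) hu.1 huM
    have hvw : Integrable fun s : ℝ => ((|s| ^ (γ - 2) : ℝ) : ℂ) * angularFourier u s := by
      have := integrable_abs_sub_rpow_mul (by linarith : -1 < γ - 2) (by linarith) hv
        (norm_angularFourier_le u) 0
      simpa only [zero_sub, abs_neg] using this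
    have hsq : ∀ s : ℝ, |s| ^ γ = s ^ 2 * |s| ^ (γ - 2) := fun s => by
      rcases eq_or_ne s 0 with rfl | hs
      · simp [(by linarith : γ ≠ 0)]
      · rw [← sq_abs, ← Real.rpow_two, ← Real.rpow_add (abs_pos.2 hs)]
        congr 1; ring
    have i2 : Integrable fun s : ℝ => (s : ℂ) * (s * (((|s| ^ (γ - 2) : ℝ) : ℂ) *
        angularFourier u s)) :=
      (hu.integrable_mul (w := fun s => ((|s| ^ γ : ℝ) : ℂ)) (by fun_prop) fun s => by
        rw [Complex.norm_real, Real.norm_of_nonneg (by positivity)]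
        exact abs_rpow_le_one_add_abs_rpow (by linarith) (by linarith) s).congr
        (.of_forall fun s => by simp only [hsq]; push_cast; ring)
    have i1 : Integrable fun s : ℝ => (s : ℂ) * (((|s| ^ (γ - 2) : ℝ) : ℂ) *
        angularFourier u s) := by
      -- The first moment is dominated through `|s| ≤ 1 + s²`.
      refine (hvw.norm.add i2.norm).mono'
        (Complex.measurable_ofReal.aestronglyMeasurable.mul hvw.aestronglyMeasurable)
        (.of_forall fun s => ?_)
      simp only [Pi.add_apply]
      rw [norm_mul, norm_mul (s : ℂ) ((s : ℂ) * _), norm_mul (s : ℂ)]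
      set t := ‖((|s| ^ (γ - 2) : ℝ) : ℂ) * angularFourier u s‖
      have ht : 0 ≤ t := norm_nonneg _
      nlinarith [mul_nonneg ht (sq_nonneg (‖(s : ℂ)‖ - 1)), mul_nonneg ht (norm_nonneg (s : ℂ))]
    obtain ⟨d1, d2, d3⟩ := deriv_deriv_integral_cexp_mul hvw i1 i2 _
      (rieszIntegral_eq h1 h2 hu.1 hc hv huw hvw)
    refine ⟨by rw [RieszDifferentiable, if_neg h2.ne]; exact ⟨huw, d1, d2⟩, fun x => ?_⟩
    have hcos : Real.cos (Real.pi / 2 * γ) < 0 :=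
      Real.cos_neg_of_pi_div_two_lt_of_lt (by nlinarith [Real.pi_pos]) (by nlinarith [Real.pi_pos])
    have hΓ : 0 < Real.Gamma (2 - γ) := Real.Gamma_pos_of_pos (by linarith)
    have hκ : -(1 / (2 * Real.cos (Real.pi / 2 * γ) * Real.Gamma (2 - γ))) *
        -(2 * Real.cos (Real.pi / 2 * γ) * Real.Gamma (2 - γ)) = 1 := by
      rw [neg_mul_neg, one_div_mul_cancel (by simp [hcos.ne, hΓ.ne'])]
    rw [rieszDeriv, if_neg h2.ne, d3, mul_neg, ← mul_assoc, ← mul_assoc, ← Complex.ofReal_mul,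
      hκ, Complex.ofReal_one, one_mul]
    congr 3
    ext s
    rw [hsq]
    push_cast
    ring

theorem abs_rpow_neg_mul_genProfile_sub_le {γ C : ℝ} (hC : ∀ y : ℝ,
    |genProfile γ (2 - 2 * Real.cos y) - |y| ^ γ| ≤ C * (|y| ^ γ * |y| ^ 6)) {h : ℝ} (hh : 0 < h)
    (s : ℝ) : |h ^ (-γ) * genProfile γ (2 - 2 * Real.cos (h * s)) - |s| ^ γ| ≤
      C * h ^ 6 * (|s| ^ γ * |s| ^ 6) := by
  have hp : 0 < h ^ γ := Real.rpow_pos_of_pos hh _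
  have := hC (h * s)
  rw [abs_mul, abs_of_pos hh, Real.mul_rpow hh.le (abs_nonneg s), mul_pow] at this
  calc |h ^ (-γ) * genProfile γ (2 - 2 * Real.cos (h * s)) - |s| ^ γ|
      = h ^ (-γ) * |genProfile γ (2 - 2 * Real.cos (h * s)) - h ^ γ * |s| ^ γ| := by
        rw [← abs_of_pos (Real.rpow_pos_of_pos hh (-γ)), ← abs_mul,
          abs_of_pos (Real.rpow_pos_of_pos hh (-γ)), Real.rpow_neg hh.le]
        congr 1
        field_simp
    _ ≤ h ^ (-γ) * (C * (h ^ γ * |s| ^ γ * (h ^ 6 * |s| ^ 6))) := by gcongr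
    _ = _ := by
        rw [Real.rpow_neg hh.le]
        field_simp

theorem theorem2p1 (γ : ℝ) (hγ₁ : 1 < γ) (hγ₂ : γ ≤ 2) (u : ℝ → ℂ) (hu : FourierSmooth (6 + γ) u)
    (hcont : Continuous u) :
    RieszDifferentiable γ u ∧
    (∀ h : ℝ, 0 < h → ∀ x : ℝ, Summable (fun m : ℤ => genCoeff γ m * u (x - m * h))) ∧
    ∃ C : ℝ, ∃ h₀ : ℝ, 0 < h₀ ∧ ∀ h : ℝ, 0 < h → h < h₀ → ∀ x : ℝ,
      ‖rieszDeriv γ u x - fracDiff γ h u x‖ ≤ C * h ^ 6 := by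
  have hv := hu.integrable_angularFourier (by linarith)
  obtain ⟨hd, hR⟩ := rieszDifferentiable_and_rieszDeriv_eq hγ₁ hγ₂ hu hcont
  have hS := fun h x => hasSum_genCoeff_mul_translate (h := h) hγ₁.le hu.1 hcont hv x
  refine ⟨hd, fun h _ x => (hS h x).summable, ?_⟩
  obtain ⟨C, hC⟩ := exists_genProfile_bound (by linarith : 0 < γ)
  set J := ∫ s, |s| ^ γ * |s| ^ 6 * ‖angularFourier u s‖ with hJ
  have hw : ∀ s : ℝ, |s| ^ γ * |s| ^ 6 = |s| ^ (6 + γ) := fun s => by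
    rw [← Real.rpow_natCast, ← Real.rpow_add_of_nonneg (abs_nonneg s) (by linarith) (by positivity)]
    congr 1; push_cast; ring
  have hJi : Integrable fun s => |s| ^ γ * |s| ^ 6 * ‖angularFourier u s‖ := by
    refine (hu.integrable_mul (w := fun s => ((|s| ^ (6 + γ) : ℝ) : ℂ)) (by fun_prop) fun s => ?_)
      |>.norm.congr (.of_forall fun s => ?_)
    · rw [Complex.norm_real, Real.norm_of_nonneg (by positivity)]
      exact abs_rpow_le_one_add_abs_rpow (by linarith) le_rfl s
    · simp only [norm_mul, Complex.norm_real, hw]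
      rw [Real.norm_of_nonneg (by positivity)]
  have hγi : Integrable fun s : ℝ => ((|s| ^ γ : ℝ) : ℂ) * angularFourier u s :=
    hu.integrable_mul (by fun_prop) fun s => by
      rw [Complex.norm_real, Real.norm_of_nonneg (by positivity)]
      exact abs_rpow_le_one_add_abs_rpow (by linarith) (by linarith) s
  -- The estimate holds for every `h > 0`, so `h₀ = 1` is arbitrary.
  refine ⟨1 / (2 * Real.pi) * (C * J), 1, one_pos, fun h hh _ x => ?_⟩
  have hb := abs_rpow_neg_mul_genProfile_sub_le hC hh
  have hgi : Integrable fun s : ℝ => ((h ^ (-γ) * genProfile γ (2 - 2 * Real.cos (h * s)) : ℝ) : ℂ) *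
      angularFourier u s := by
    have hm : Measurable fun s : ℝ =>
        ((h ^ (-γ) * genProfile γ (2 - 2 * Real.cos (h * s)) : ℝ) : ℂ) := by
      unfold genProfile; fun_prop
    have := (hJi.const_mul (C * h ^ 6)).mono' (f := fun s : ℝ =>
      ((h ^ (-γ) * genProfile γ (2 - 2 * Real.cos (h * s)) - |s| ^ γ : ℝ) : ℂ) *
      angularFourier u s) ?_ (.of_forall fun s => ?_)
    · refine (this.add hγi).congr (.of_forall fun s => ?_)
      simp only [Pi.add_apply]
      push_cast
      ring
    · refine Measurable.aestronglyMeasurable ?_ |>.mul hv.aestronglyMeasurable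
      unfold genProfile; fun_prop
    · rw [norm_mul, Complex.norm_real, ← mul_assoc]
      exact mul_le_mul_of_nonneg_right (hb s) (norm_nonneg _)
  have key : rieszDeriv γ u x - fracDiff γ h u x = 1 / (2 * Real.pi) *
      ∫ s : ℝ, Complex.exp (Complex.I * (s * x : ℝ)) *
        (((h ^ (-γ) * genProfile γ (2 - 2 * Real.cos (h * s)) - |s| ^ γ : ℝ) : ℂ) *
          angularFourier u s) := by
    have e : (fun s : ℝ => Complex.exp (Complex.I * (s * x : ℝ)) *
        (((h ^ (-γ) * genProfile γ (2 - 2 * Real.cos (h * s)) - |s| ^ γ : ℝ) : ℂ) *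
          angularFourier u s)) = fun s : ℝ => Complex.exp (Complex.I * (s * x : ℝ)) *
        (((h ^ (-γ) * genProfile γ (2 - 2 * Real.cos (h * s)) : ℝ) : ℂ) * angularFourier u s) -
        Complex.exp (Complex.I * (s * x : ℝ)) * (((|s| ^ γ : ℝ) : ℂ) * angularFourier u s) := by
      ext s; push_cast; ring
    rw [e, integral_sub (integrable_cexp_mul hgi x) (integrable_cexp_mul hγi x), hR, fracDiff,
      (hS h x).tsum_eq]
    simp only [Complex.ofReal_mul (h ^ (-γ)), mul_assoc (Complex.ofReal (h ^ (-γ))),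
      mul_left_comm (Complex.exp _) (Complex.ofReal (h ^ (-γ)))]
    rw [integral_const_mul]
    ring
  rw [key, norm_mul, mul_assoc]
  refine mul_le_mul (le_of_eq ?_) ?_ (norm_nonneg _) (by positivity)
  · simp [abs_of_pos Real.pi_pos]
  · rw [mul_right_comm, hJ, ← integral_const_mul]
    refine norm_integral_le_of_norm_le (hJi.const_mul _) (.of_forall fun s => ?_)
    rw [norm_mul, norm_cexp_I_mul, one_mul, norm_mul, Complex.norm_real, ← mul_assoc]
    exact mul_le_mul_of_nonneg_right (hb s) (norm_nonneg _)
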